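/- \textbf{Setting.} Let $R$ be a commutative ring of complex functions with a complex conjugation: a complete Hausdorff $\mathbb C$-algebra with conjugate-linear involution whose topology is given by submultiplicative seminorms (e.g. smooth functions on a manifold, or formal power series over these). Let $\mathcal V$ be an $R$-module of continuous derivations of $R$ closed under commutators (the vector fields); 1-forms are $R$-linear functionals on $\mathcal V$. Fix an integer $N\ge 0$ and a real constant $\gamma\neq 0$. A dot denotes $\lambda\,\partial/\partial\lambda$, $\operatorname{Res}_{\lambda=0}$ takes the coefficient of $\lambda^0$, and $\boldsymbol{\mathfrak g}$ is the twisted loop algebra of trace-free $2\times2$ matrices of formal Laurent series in $\lambda$ (bounded below in degree) with even diagonal and odd off-diagonal entries; $A_{\le -1}$ is the part of $\lambda$-degree $\le -1$, and $\bar A^t$ is the conjugate transpose with $\bar\lambda=\lambda^{-1}$. \textbf{The hierarchy.} Let $t_0,\dots,t_N\in R$, let $h_2^{1/2}\in R$ be invertible, $\rho$ a 1-form, and $Y,S$ functions with values in $\boldsymbol{\mathfrak g}$, where $Y$ has only terms of positive $\lambda$-degree, $\det Y=-4\gamma\lambda^2$, and the $\lambda^1$-coefficients of $Y^1_2,Y^2_1$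 are $2ih_2^{1/2}$ and $-2i\gamma h_2^{-1/2}$. Put $$U_m=\Big(\tfrac1{2i}\lambda^{-(2m+2)}Y\Big)_{\le-1},\qquad S_k=(\lambda^{-2k}S)_{\le -1},\qquad \phi=-\sum_{m=0}^N\bar U_m^t\,d\bar t_m+\begin{pmatrix}\frac i2\rho&0\\0&-\frac i2\rho\end{pmatrix}+\sum_{m=0}^N U_m\,dt_m .$$ Let $\sigma_k$ ($k\ge N+1$; written $\bar\sigma_k$ in the $(+)$ case) be 1-forms, finitely many of which are nonzero on each vector field, and let either $$(+)\quad \sigma=-\sum_{\ell}\lambda^{2\ell}\bar\sigma_\ell,\quad \hat\varphi=\phi-\sum_\ell \bar S_\ell^t\,\bar\sigma_\ell,\quad e^u\in\lambda^{2N+2}R[[\lambda^2]],$$ or $$(-)\quad \sigma=\sum_k\lambda^{-2k}\sigma_k,\quad \hat\varphi=\phi+\sum_k S_k\sigma_k,\quad e^u\in\lambda^{-(2N+2)}R[[\lambda^{-2}]].$$ The extended CMC hierarchy is the system $$dY+[\hat\varphi,Y]+(\dot Y-Y)\sigma=0,\qquad dS+[\hat\varphi,S]+S\dot\sigma+\dot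 S\sigma=\dot{\hat\varphi},$$ $$d\sigma+\sigma\wedge\dot\sigma=0,\qquad d(e^u)=e^u\dot\sigma-(e^u)^{\textstyle\cdot}\,\sigma,\qquad d\hat\varphi+\hat\varphi\wedge\hat\varphi=\dot{\hat\varphi}\wedge\sigma .$$ \textbf{Theorem.} Consider any solution of the extended CMC hierarchy, with either sign. In the $(-)$ case, where the coefficients of products with $e^u$ are infinite sums, assume that the products $e^u\det S$ and $(e^u)^{\textstyle\cdot}\det S$ exist, i.e. all their coefficients are summable. Then the sums defining $\operatorname{Res}_{\lambda=0}(e^u\det S)$ and $$\varphi_S:=-\operatorname{Res}_{\lambda=0}\operatorname{tr}\big(e^uS\,\dot{\hat\varphi}\big)$$ converge, $\varphi_S$ is a closed 1-form, and $$d\big(\operatorname{Res}_{\lambda=0}(e^u\det S)\big)=\varphi_S .$$ Hence $$\tau=\exp\big(\operatorname{Res}_{\lambda=0}(e^u\det S)\big)$$ is a tau function, i.e. it is invertible with $d\log\tau=\varphi_S$, and every tau function is this one times an invertible element that is annihilated by all vector fields in $\mathcal V$. In the un-extended case, where $dY+[\phi,Y]=0$, $d\phi+\phi\wedge\phi=0$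 and $dS+[\phi,S]=\dot\phi$, one has $d(\det S)=-\operatorname{tr}(S\dot\phi)$, the 1-form $\varphi_S:=-\operatorname{Res}_{\lambda=0}\operatorname{tr}(S\dot\phi)$ is closed and equals $d(\operatorname{Res}_{\lambda=0}\det S)$, and $\tau=\exp(\operatorname{Res}_{\lambda=0}\det S)$ is a tau function in the same sense, again unique up to an invertible factor annihilated by all vector fields. -/

import Mathlib

open scoped Matrix

noncomputable section

namespace CMC

/-! ## Rings of functions and vector fields -/

/-- A complete Hausdorff topological `ℂ`-algebra whose topology is given by submultiplicative
seminorms.  Examples are the algebra of smooth complex functions on a manifold with its `C^∞`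
topology, and algebras of formal power series over it.  In such an algebra the exponential
series always converges. -/
class IsFunctionAlgebra (R : Type*) [CommRing R] [Algebra ℂ R] [UniformSpace R] : Prop
    extends IsUniformAddGroup R, IsTopologicalRing R, CompleteSpace R, T2Space R where
  mconvex : ∃ P : Set (Seminorm ℂ R), P.Nonempty ∧
    (∀ p ∈ P, ∀ x y, p (x * y) ≤ p x * p y) ∧
    WithSeminorms (fun p : P => (p : Seminorm ℂ R))

/-- A Lie algebra of (complexified) vector fields: an `R`-module of continuous derivations of the
ring of functions `R` which is closed under the commutator.  Differential 1-forms are the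
`R`-linear functionals on it. -/
structure VectorFields (R : Type*) [CommRing R] [Algebra ℂ R] [TopologicalSpace R] where
  carrier : Submodule R (Derivation ℂ R R)
  lie_mem : ∀ {X Y : Derivation ℂ R R}, X ∈ carrier → Y ∈ carrier → ⁅X, Y⁆ ∈ carrier
  continuous : ∀ X ∈ carrier, Continuous X

section Calculus

variable {R : Type*} [CommRing R] [Algebra ℂ R] [TopologicalSpace R]

/-- The Lie bracket of vector fields. -/
def VectorFields.bracket (V : VectorFields R) (X Y : V.carrier) : V.carrier :=
  ⟨⁅X.1, Y.1⁆, V.lie_mem X.2 Y.2⟩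

/-- `ω` is a closed 1-form: `dω(X,Y) = X ω(Y) - Y ω(X) - ω([X,Y])` vanishes. -/
def IsClosedForm (V : VectorFields R) (ω : V.carrier → R) : Prop :=
  ∀ X Y : V.carrier, X.1 (ω Y) - Y.1 (ω X) - ω (V.bracket X Y) = 0

/-- `df = ω`. -/
def IsPotential (V : VectorFields R) (ω : V.carrier → R) (f : R) : Prop :=
  ∀ X : V.carrier, X.1 f = ω X

/-- `τ` is invertible and `d log τ = τ⁻¹ dτ = ω`. -/
def IsTau (V : VectorFields R) (ω : V.carrier → R) (τ : R) : Prop :=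
  IsUnit τ ∧ ∀ X : V.carrier, X.1 τ = τ * ω X

end Calculus

/-! ## Formal series in the spectral parameter `λ` -/

section Series

variable {R : Type*} [CommRing R]

/-- `2 × 2` matrices of formal Laurent series in `λ`. -/
abbrev Loop (R : Type*) [CommRing R] := Matrix (Fin 2) (Fin 2) (LaurentSeries R)

/-- The twisted loop algebra: trace-free, diagonal entries even in `λ`, off-diagonal entries odd. -/
def IsTwisted (A : Loop R) : Prop :=
  A 1 1 = -A 0 0 ∧ (∀ n : ℤ, Odd n → (A 0 0).coeff n = 0) ∧
    (∀ n : ℤ, Even n → (A 0 1).coeff n = 0 ∧ (A 1 0).coeff n = 0)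

/-- The monomial `c λⁿ`. -/
abbrev mono (n : ℤ) (c : R) : LaurentSeries R := HahnSeries.single n c

/-- The Euler operator `λ d/dλ` (the upper dot). -/
def euler (f : LaurentSeries R) : LaurentSeries R where
  coeff n := (n : R) * f.coeff n
  isPWO_support' := f.isPWO_support.mono fun n hn hz => hn (by simp [hz])

/-- The Euler operator on matrices. -/
def eulerM (A : Loop R) : Loop R := A.map euler

/-- The residue operator: the coefficient of `λ⁰`. -/
def res (f : LaurentSeries R) : R := f.coeff 0

/-- The part of `λ`-degree `≤ -1`. -/
def negPart (f : LaurentSeries R) : LaurentSeries R where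
  coeff n := if n ≤ -1 then f.coeff n else 0
  isPWO_support' := f.isPWO_support.mono fun n hn hz => hn (by simp [hz])

/-- The formal complex conjugate (conjugation of the coefficients, `λ ↦ λ⁻¹`)
of the part of `λ`-degree `≤ -1`. -/
def negPartConj [StarRing R] (f : LaurentSeries R) : LaurentSeries R :=
  HahnSeries.ofSuppBddBelow (fun n : ℤ => if 1 ≤ n then star (f.coeff (-n)) else 0)
    ⟨1, fun n hn => by
      by_contra h
      exact hn (by simp [h])⟩

/-- A vector field acting on the coefficients of a Laurent series. -/
def lieD [Algebra ℂ R] (X : Derivation ℂ R R) (f : LaurentSeries R) : LaurentSeries R := f.map X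

/-- A vector field acting on a matrix of Laurent series. -/
def lieDM [Algebra ℂ R] (X : Derivation ℂ R R) (A : Loop R) : Loop R := A.map (lieD X)

/-- The Euler operator on series `∑ Eₙ λⁿ`, given by their coefficients `E : ℤ → R`, that may be
infinite in either direction. -/
def eulerZ (E : ℤ → R) (n : ℤ) : R := (n : R) * E n

/-- The product of a Laurent polynomial `s` with a series `∑ Eₙ λⁿ`. -/
def polyMul (s : LaurentSeries R) (E : ℤ → R) (n : ℤ) : R := ∑ᶠ i : ℤ, s.coeff i * E (n - i)

/-- All coefficients of the product of `∑ Eₙ λⁿ` and `f` are summable. -/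
def ProductExists [TopologicalSpace R] (E : ℤ → R) (f : LaurentSeries R) : Prop :=
  ∀ n : ℤ, Summable fun i : ℤ => E i * f.coeff (n - i)

/-- The residue of the product of `∑ Eₙ λⁿ` and `f`. -/
def resMul [TopologicalSpace R] (E : ℤ → R) (f : LaurentSeries R) : R :=
  ∑' i : ℤ, E i * f.coeff (-i)

end Series

/-! ## The truncated CMC hierarchy and its extension -/

section Hierarchy

variable {R : Type*} [CommRing R] [StarRing R] [Algebra ℂ R] [TopologicalSpace R]

/-- The unknowns of the `t_N`-truncated CMC hierarchy together with a spectral Killing field,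
subject to the algebraic constraints only.
* `t m` are the time variables, their conjugates being `star (t m)`;
* `q = h₂^{1/2}`, and `ξ` is determined by `dt₀ = -½ h₂^{1/2} ξ`;
* `ρ` is the connection form;
* `Y` is the formal Killing field, whose off-diagonal entries begin with `2c² = 2 i h₂^{1/2}` and
  `2b² = -2 i γ h₂^{-1/2}`;
* `S` is a function with values in the twisted loop algebra. -/
structure Data (V : VectorFields R) (N : ℕ) (γ : ℝ) where
  t : Fin (N + 1) → R
  q : Rˣ
  ρ : V.carrier →ₗ[R] R
  Y : Loop R
  S : Loop R
  γ_ne_zero : γ ≠ 0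
  Y_twisted : IsTwisted Y
  Y_pos : ∀ i j, ∀ n : ℤ, n ≤ 0 → (Y i j).coeff n = 0
  Y_c : (Y 0 1).coeff 1 = (2 * Complex.I) • (q : R)
  Y_b : (Y 1 0).coeff 1 = (-2 * Complex.I * γ) • ((q⁻¹ : Rˣ) : R)
  Y_det : Y.det = mono 2 (algebraMap ℂ R (-4 * γ))
  S_twisted : IsTwisted S

namespace Data

variable {V : VectorFields R} {N : ℕ} {γ : ℝ} (D : Data V N γ)

/-- `(1/2i) λ^{-(2m+2)} Y = U_m + U_{(m+1)}`. -/
def scaledY (m : ℕ) : Loop R :=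
  mono (-(2 * (m : ℤ) + 2)) (algebraMap ℂ R (1 / (2 * Complex.I))) • D.Y

/-- `U_m`, the part of degree `≤ -1` of `(1/2i) λ^{-(2m+2)} Y`. -/
def U (m : ℕ) : Loop R := (D.scaledY m).map negPart

/-- The conjugate transpose of `U_m`. -/
def Ubar (m : ℕ) : Loop R := ((D.scaledY m).map negPartConj)ᵀ

/-- `S_k`, the part of degree `≤ -1` of `λ^{-2k} S`. -/
def Sk (k : ℕ) : Loop R := (mono (-(2 * (k : ℤ))) (1 : R) • D.S).map negPart

/-- The conjugate transpose of `S_k`. -/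
def Skbar (k : ℕ) : Loop R := ((mono (-(2 * (k : ℤ))) (1 : R) • D.S).map negPartConj)ᵀ

/-- `φ₀ = diag(iρ/2, -iρ/2)`. -/
def φ₀ (X : V.carrier) : Loop R :=
  !![mono 0 ((Complex.I / 2) • D.ρ X), 0; 0, mono 0 (-((Complex.I / 2) • D.ρ X))]

/-- The Maurer-Cartan form `φ = -∑ Ūᵗ_m dt̄_m + φ₀ + ∑ U_m dt_m`. -/
def φ (X : V.carrier) : Loop R :=
  -(∑ m : Fin (N + 1), X.1 (star (D.t m)) • D.Ubar m) + D.φ₀ X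
    + ∑ m : Fin (N + 1), X.1 (D.t m) • D.U m

end Data

/-- The truncated (un-extended) CMC hierarchy with a spectral Killing field:
`dY + [φ,Y] = 0`, `dφ + φ ∧ φ = 0`, `dS + [φ,S] = φ̇`. -/
structure Hierarchy (V : VectorFields R) (N : ℕ) (γ : ℝ) extends Data V N γ where
  eq_Y : ∀ X : V.carrier, lieDM X.1 Y + ⁅toData.φ X, Y⁆ = 0
  eq_φ : ∀ X Z : V.carrier,
    lieDM X.1 (toData.φ Z) - lieDM Z.1 (toData.φ X) - toData.φ (V.bracket X Z)
      + (toData.φ X * toData.φ Z - toData.φ Z * toData.φ X) = 0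
  eq_S : ∀ X : V.carrier, lieDM X.1 S + ⁅toData.φ X, S⁆ = eulerM (toData.φ X)

namespace Hierarchy

variable {V : VectorFields R} {N : ℕ} {γ : ℝ} (H : Hierarchy V N γ)

/-- The 1-form `-Res tr(S φ̇)`. -/
def φS (X : V.carrier) : R := -res (Matrix.trace (H.S * eulerM (H.toData.φ X)))

/-- `Res det S`. -/
def logTau : R := res H.S.det

end Hierarchy

/-- The type (positive or negative) of the truncated Virasoro algebra. -/
inductive VirType
  | pos
  | neg

/-- The value of the generating 1-form on a vector field with `σ_k(X) = s k`:
`σ₊ = ∑ -λ^{2ℓ} σ̄_ℓ` and `σ₋ = ∑ λ^{-2k} σ_k`. -/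
def VirType.series : VirType → (ℕ →₀ R) → LaurentSeries R
  | .pos, s => s.sum fun l c => mono (2 * (l : ℤ)) (-c)
  | .neg, s => s.sum fun k c => mono (-(2 * (k : ℤ))) c

/-- The extended Maurer-Cartan form `φ̂₊ = φ - ∑ S̄ᵗ_ℓ σ̄_ℓ`, resp. `φ̂₋ = φ + ∑ S_k σ_k`. -/
def Data.extφ {V : VectorFields R} {N : ℕ} {γ : ℝ} (D : Data V N γ) (ε : VirType)
    (σ : V.carrier →ₗ[R] (ℕ →₀ R)) (X : V.carrier) : Loop R :=
  match ε with
  | .pos => D.φ X - (σ X).sum fun l c => c • D.Skbar l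
  | .neg => D.φ X + (σ X).sum fun k c => c • D.Sk k

/-- The extended CMC hierarchy of type `ε`.  Here `σ X k` is the value `σ_k(X)` (`σ̄_k(X)` for the
positive type); these 1-forms are formally dual to vector fields `∂_k`, so that only finitely many
of them are nonzero on each vector field.  `E` is the sequence of the `λ`-coefficients of `e^u`, an
even series in `λ^{2N+2} R[[λ²]]` for the positive and in `λ^{-(2N+2)} R[[λ⁻²]]` for the negative
type; its equation is `d(e^u) = e^u σ̇ - (e^u)˙ σ`, that is `du = σ̇ - u̇ σ`. -/
structure ExtHierarchy (V : VectorFields R) (N : ℕ) (γ : ℝ) (ε : VirType)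
    extends Data V N γ where
  σ : V.carrier →ₗ[R] (ℕ →₀ R)
  E : ℤ → R
  σ_truncated : ∀ X : V.carrier, ∀ k ≤ N, σ X k = 0
  E_even : ∀ n : ℤ, Odd n → E n = 0
  E_support : match ε with
    | .pos => ∀ n : ℤ, n < 2 * N + 2 → E n = 0
    | .neg => ∀ n : ℤ, -(2 * N + 2) < n → E n = 0
  eq_Y : ∀ X : V.carrier, lieDM X.1 Y + ⁅toData.extφ ε σ X, Y⁆
    + ε.series (σ X) • (eulerM Y - Y) = 0
  eq_S : ∀ X : V.carrier, lieDM X.1 S + ⁅toData.extφ ε σ X, S⁆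
    + (euler (ε.series (σ X)) • S + ε.series (σ X) • eulerM S) = eulerM (toData.extφ ε σ X)
  eq_σ : ∀ X Z : V.carrier,
    lieD X.1 (ε.series (σ Z)) - lieD Z.1 (ε.series (σ X)) - ε.series (σ (V.bracket X Z))
      + (ε.series (σ X) * euler (ε.series (σ Z)) - ε.series (σ Z) * euler (ε.series (σ X))) = 0
  eq_E : ∀ X : V.carrier, ∀ n : ℤ, X.1 (E n) =
    polyMul (euler (ε.series (σ X))) E n - polyMul (ε.series (σ X)) (eulerZ E) n
  eq_φ : ∀ X Z : V.carrier,
    lieDM X.1 (toData.extφ ε σ Z) - lieDM Z.1 (toData.extφ ε σ X)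
      - toData.extφ ε σ (V.bracket X Z)
      + (toData.extφ ε σ X * toData.extφ ε σ Z - toData.extφ ε σ Z * toData.extφ ε σ X)
    = ε.series (σ Z) • eulerM (toData.extφ ε σ X) - ε.series (σ X) • eulerM (toData.extφ ε σ Z)

namespace ExtHierarchy

variable {V : VectorFields R} {N : ℕ} {γ : ℝ} {ε : VirType} (H : ExtHierarchy V N γ ε)

/-- `φ̂`. -/
def hatφ (X : V.carrier) : Loop R := H.toData.extφ ε H.σ X

/-- The 1-form `φ_S = -Res tr(e^u S φ̂˙)`. -/
def φS (X : V.carrier) : R := -resMul H.E (Matrix.trace (H.S * eulerM (H.hatφ X)))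

/-- `Res(e^u det S)`. -/
def logTau : R := resMul H.E H.S.det

end ExtHierarchy

end Hierarchy

end CMC

end

/-!
The commutator in the equation for `S` is orthogonal to `S`, and `det S = -½ tr S²` for trace-free
`S`.  Hence the equation for `S` gives `d det S = -tr (S φ̇)` for the hierarchy itself, and
`d det S = -tr (S φ̂˙) - 2 σ̇ det S - σ (det S)˙` for its extension (`lieD_det`).  Together with
`d (e^u) = e^u σ̇ - (e^u)˙ σ` this becomes
`d (e^u det S) = -e^u tr (S φ̂˙) - (σ e^u det S)˙`, and the last term has no residue because it is an
Euler derivative.  So `Res (e^u det S)` is a potential of `φ_S`.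

The products with `e^u` may be infinite sums, so the identity is proved for summable families
(`hasSum_mul_coeff_neg`): vector fields are continuous and may be applied termwise, and since `σ` is
a Laurent polynomial in `λ`, every term other than `e^u tr (S φ̂˙)` is a finite combination of shifts
of the coefficients of `e^u det S` and `(e^u)˙ det S`.  This also yields the convergence of `φ_S`.

An exact form `ω = df` is closed, and its tau functions are the multiples of `exp f` by invertible
constants (`IsPotential.isTau_exp`, `IsPotential.isTau_iff`), because the exponential series
converges absolutely in every defining seminorm, `exp f` has the inverse `exp (-f)`, and
`X (exp f) = exp f · X f` (`derivation_exp`).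
-/

namespace CMC

/-! ### The exponential in a function algebra -/

section Exponential

open NormedSpace

variable {R : Type*} [CommRing R] [Algebra ℂ R]

/-- A submultiplicative seminorm need not satisfy `p 1 ≤ 1`, whence the factor `1 + p 1`. -/
theorem seminorm_expTerm_le {p : Seminorm ℂ R} (hp : ∀ x y, p (x * y) ≤ p x * p y) (f : R)
    (n : ℕ) : p ((n.factorial⁻¹ : ℂ) • f ^ n) ≤ (1 + p 1) * (p f ^ n / n.factorial) := by
  have hpow : p (f ^ n) ≤ (1 + p 1) * p f ^ n := by
    rcases n with _ | n
    · simp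
    · have : p (f ^ (n + 1)) ≤ p f ^ (n + 1) := by
        induction n with
        | zero => simp
        | succ n ih =>
          rw [pow_succ, pow_succ _ (n + 1)]
          exact (hp _ _).trans (mul_le_mul_of_nonneg_right ih (apply_nonneg p f))
      refine this.trans (le_mul_of_one_le_left (pow_nonneg (apply_nonneg p f) _) ?_)
      linarith [apply_nonneg p 1]
  rw [map_smul_eq_mul, norm_inv, RCLike.norm_natCast, ← mul_div_assoc, div_eq_inv_mul]
  exact mul_le_mul_of_nonneg_left hpow (by positivity)

variable [UniformSpace R] [IsFunctionAlgebra R]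

/-- A family that is absolutely summable for each of the defining seminorms is summable. -/
theorem summable_of_seminorm {ι : Type*} {P : Set (Seminorm ℂ R)}
    (hP : WithSeminorms (fun p : P => (p : Seminorm ℂ R))) {f : ι → R}
    (hf : ∀ p ∈ P, Summable fun i => p (f i)) : Summable f := by
  rw [summable_iff_vanishing]
  intro e he
  obtain ⟨s, r, hr, hsub⟩ := (hP.mem_nhds_iff 0 e).1 he
  have hsum : Summable fun i => ∑ p ∈ s, (p : Seminorm ℂ R) (f i) :=
    summable_sum fun p _ => hf p p.2
  obtain ⟨F, hF⟩ := summable_iff_vanishing.1 hsum _ (Metric.ball_mem_nhds (0 : ℝ) hr)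
  refine ⟨F, fun t ht => hsub ?_⟩
  have h1 := hF t ht
  rw [Metric.mem_ball, dist_zero_right] at h1
  rw [Seminorm.mem_ball_zero]
  calc (s.sup fun p : P => (p : Seminorm ℂ R)) (∑ i ∈ t, f i)
      ≤ ∑ i ∈ t, (s.sup fun p : P => (p : Seminorm ℂ R)) (f i) :=
        Finset.le_sum_of_subadditive _ (map_zero _).le (map_add_le_add _) _ _
    _ ≤ ∑ i ∈ t, ∑ p ∈ s, (p : Seminorm ℂ R) (f i) := by
        refine Finset.sum_le_sum fun i _ => ?_
        exact Seminorm.finset_sup_apply_le (Finset.sum_nonneg fun p _ => apply_nonneg p.1 _)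
          fun p hp => Finset.single_le_sum (f := fun p : P => (p : Seminorm ℂ R) (f i))
            (fun p _ => apply_nonneg p.1 _) hp
    _ < r := (le_abs_self _).trans_lt h1

theorem summable_expTerm (f : R) : Summable fun n : ℕ => (n.factorial⁻¹ : ℂ) • f ^ n := by
  obtain ⟨P, -, hsub, hP⟩ := IsFunctionAlgebra.mconvex (R := R)
  exact summable_of_seminorm hP fun p hp => Summable.of_nonneg_of_le
    (fun n => apply_nonneg p _) (seminorm_expTerm_le (hsub p hp) f)
    ((Real.summable_pow_div_factorial (p f)).mul_left _)

/-- The double family underlying the Cauchy product `exp f * exp g`. -/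
theorem summable_expTerm_mul (f g : R) : Summable fun x : ℕ × ℕ =>
    ((x.1.factorial⁻¹ : ℂ) • f ^ x.1) * ((x.2.factorial⁻¹ : ℂ) • g ^ x.2) := by
  obtain ⟨P, -, hsub, hP⟩ := IsFunctionAlgebra.mconvex (R := R)
  refine summable_of_seminorm hP fun p hp => Summable.of_nonneg_of_le
    (fun n => apply_nonneg p _) (fun x => (hsub p hp _ _).trans
      (mul_le_mul (seminorm_expTerm_le (hsub p hp) f _) (seminorm_expTerm_le (hsub p hp) g _)
        (apply_nonneg p _) ((apply_nonneg p _).trans (seminorm_expTerm_le (hsub p hp) f _)))) ?_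
  have h := fun h : R => (Real.summable_pow_div_factorial (p h)).mul_left (1 + p 1)
  exact (h f).mul_of_nonneg (h g)
    (fun n => mul_nonneg (by positivity) (div_nonneg (pow_nonneg (apply_nonneg p f) _)
      (by positivity)))
    (fun n => mul_nonneg (by positivity) (div_nonneg (pow_nonneg (apply_nonneg p g) _)
      (by positivity)))

theorem hasSum_exp (f : R) : HasSum (fun n : ℕ => (n.factorial⁻¹ : ℂ) • f ^ n) (exp f) := by
  rw [exp_eq_tsum ℂ]
  exact (summable_expTerm f).hasSum

theorem exp_mul_exp_neg (f : R) : exp f * exp (-f) = 1 := by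
  rw [exp_eq_tsum ℂ]
  dsimp only
  rw [(summable_expTerm f).tsum_mul_tsum_eq_tsum_sum_antidiagonal (summable_expTerm (-f))
    (summable_expTerm_mul f (-f))]
  have h : ∀ n : ℕ, ∑ kl ∈ Finset.HasAntidiagonal.antidiagonal n,
      ((kl.1.factorial⁻¹ : ℂ) • f ^ kl.1) * ((kl.2.factorial⁻¹ : ℂ) • (-f) ^ kl.2) =
        (n.factorial⁻¹ : ℂ) • (f + -f) ^ n := by
    intro n
    rw [(Commute.all f (-f)).add_pow', Finset.smul_sum]
    refine Finset.sum_congr rfl fun kl hkl => ?_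
    rw [← Finset.HasAntidiagonal.mem_antidiagonal.1 hkl, smul_mul_smul_comm,
      ← Nat.cast_smul_eq_nsmul ℂ, smul_smul, Nat.cast_add_choose ℂ]
    have h : ((kl.1 + kl.2).factorial : ℂ) ≠ 0 := by exact_mod_cast Nat.factorial_ne_zero _
    congr 1
    field_simp
  simp_rw [h]
  rw [tsum_eq_single 0 fun n hn => by simp [hn]]
  simp

/-- The chain rule `X (exp f) = exp f · X f`, by termwise differentiation of the exponential
series. -/
theorem derivation_exp {X : Derivation ℂ R R} (hX : Continuous X) (f : R) :
    X (exp f) = exp f * X f := by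
  have h1 := (hasSum_exp f).map X hX
  -- The constant term is annihilated by `X`; the derivative of the term `n + 1` is the term `n`.
  rw [← hasSum_nat_add_iff' 1] at h1
  simp only [Finset.sum_range_one, Function.comp_apply, pow_zero, X.map_smul,
    Derivation.map_one_eq_zero, smul_zero, sub_zero] at h1
  refine h1.unique (((hasSum_exp f).mul_right (X f)).congr_fun fun n => ?_)
  have hn : ((n : ℂ) + 1) ≠ 0 := by exact_mod_cast n.succ_ne_zero
  rw [Derivation.leibniz_pow, ← Nat.cast_smul_eq_nsmul ℂ, smul_smul, Nat.add_sub_cancel,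
    smul_eq_mul, smul_mul_assoc, Nat.factorial_succ]
  push_cast
  congr 1
  field_simp

end Exponential

/-! ### Tau functions of an exact 1-form -/

section Potential

variable {R : Type*} [CommRing R] [Algebra ℂ R]

theorem IsPotential.isClosedForm [TopologicalSpace R] {V : VectorFields R} {ω : V.carrier → R}
    {f : R} (h : IsPotential V ω f) : IsClosedForm V ω := by
  intro X Y
  rw [← h X, ← h Y, ← h (V.bracket X Y)]
  simp [VectorFields.bracket, Derivation.commutator_apply]

variable [UniformSpace R] [IsFunctionAlgebra R] {V : VectorFields R}
  {ω : V.carrier → R} {f : R}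

theorem IsPotential.isTau_exp (h : IsPotential V ω f) : IsTau V ω (NormedSpace.exp f) :=
  ⟨.of_mul_eq_one _ (exp_mul_exp_neg f), fun X => by
    rw [derivation_exp (V.continuous _ X.2), h X]⟩

theorem IsPotential.isTau_iff (h : IsPotential V ω f) (τ : R) :
    IsTau V ω τ ↔ ∃ c : R, IsUnit c ∧ (∀ X : V.carrier, X.1 c = 0) ∧
      τ = c * NormedSpace.exp f := by
  have he := exp_mul_exp_neg f
  constructor
  · rintro ⟨hu, hτ⟩
    refine ⟨τ * NormedSpace.exp (-f), hu.mul (.of_mul_eq_one _ ((mul_comm _ _).trans he)),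
      fun X => ?_, by linear_combination (-τ) * he⟩
    rw [Derivation.leibniz, derivation_exp (V.continuous _ X.2), hτ X, map_neg, h X]
    simp only [smul_eq_mul]
    ring
  · rintro ⟨c, hc, hX, rfl⟩
    refine ⟨hc.mul h.isTau_exp.1, fun X => ?_⟩
    rw [Derivation.leibniz, h.isTau_exp.2 X, hX X]
    simp only [smul_eq_mul]
    ring

end Potential

/-! ### Derivations of Laurent series -/

section Laurent

variable {R : Type*} [CommRing R]

@[simp] theorem euler_coeff (f : LaurentSeries R) (n : ℤ) :
    (euler f).coeff n = (n : R) * f.coeff n := rfl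

theorem euler_mul (f g : LaurentSeries R) : euler (f * g) = euler f * g + f * euler g := by
  ext n
  have hs : ∀ h : LaurentSeries R, (euler h).support ⊆ h.support :=
    fun h n hn hz => hn (by simp [show h.coeff n = 0 from hz])
  rw [euler_coeff, HahnSeries.coeff_add, HahnSeries.coeff_mul,
    HahnSeries.coeff_mul_left' f.isPWO_support (hs f),
    HahnSeries.coeff_mul_right' g.isPWO_support (hs g), ← Finset.sum_add_distrib, Finset.mul_sum]
  refine Finset.sum_congr rfl fun ij hij => ?_
  rw [← (Finset.mem_antidiagonal.1 hij).2.2]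
  simp only [euler_coeff]
  push_cast
  ring

theorem euler_add (f g : LaurentSeries R) : euler (f + g) = euler f + euler g := by
  ext n
  simp [mul_add]

theorem euler_neg (f : LaurentSeries R) : euler (-f) = -euler f := by
  ext n
  simp

/-- The product with a Laurent polynomial, as a finite sum. -/
theorem coeff_mul_of_support_subset {s : LaurentSeries R} {F : Finset ℤ}
    (hF : ∀ j ∉ F, s.coeff j = 0) (f : LaurentSeries R) (n : ℤ) :
    (s * f).coeff n = ∑ j ∈ F, s.coeff j * f.coeff (n - j) := by
  have hs : s = ∑ j ∈ F, HahnSeries.single j (s.coeff j) := by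
    ext m
    rw [HahnSeries.coeff_sum]
    by_cases hm : m ∈ F
    · rw [Finset.sum_eq_single_of_mem m hm fun j _ hj => HahnSeries.coeff_single_of_ne hj.symm,
        HahnSeries.coeff_single_same]
    · rw [Finset.sum_eq_zero fun j hj => HahnSeries.coeff_single_of_ne (by
        rintro rfl
        exact hm hj), hF m hm]
  conv_lhs => rw [hs]
  simp only [Finset.sum_mul, HahnSeries.coeff_sum, HahnSeries.coeff_single_mul]

theorem polyMul_of_support_subset {s : LaurentSeries R} {F : Finset ℤ}
    (hF : ∀ j ∉ F, s.coeff j = 0) (E : ℤ → R) (n : ℤ) :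
    polyMul s E n = ∑ j ∈ F, s.coeff j * E (n - j) :=
  finsum_eq_sum_of_support_subset _ fun j hj => by
    by_contra h
    exact hj (by simp [hF j h])

theorem VirType.exists_support_series (ε : VirType) (s : ℕ →₀ R) :
    ∃ F : Finset ℤ, ∀ j ∉ F, (ε.series s).coeff j = 0 := by
  classical
  cases ε
  · refine ⟨s.support.image fun l : ℕ => 2 * (l : ℤ), fun j hj => ?_⟩
    rw [VirType.series, Finsupp.sum, HahnSeries.coeff_sum]
    refine Finset.sum_eq_zero fun l hl => HahnSeries.coeff_single_of_ne ?_
    rintro rfl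
    exact hj (Finset.mem_image_of_mem _ hl)
  · refine ⟨s.support.image fun l : ℕ => -(2 * (l : ℤ)), fun j hj => ?_⟩
    rw [VirType.series, Finsupp.sum, HahnSeries.coeff_sum]
    refine Finset.sum_eq_zero fun l hl => HahnSeries.coeff_single_of_ne ?_
    rintro rfl
    exact hj (Finset.mem_image_of_mem _ hl)

theorem eulerZ_eq_zero {E : ℤ → R} {n : ℤ} (h : E n = 0) : eulerZ E n = 0 := by
  rw [eulerZ, h, mul_zero]

/-- Series bounded below in degree have a product, all of whose coefficients are finite sums. -/
theorem productExists_of_bddBelow [TopologicalSpace R] {E : ℤ → R} {m : ℤ}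
    (hE : ∀ n < m, E n = 0) (f : LaurentSeries R) : ProductExists E f := by
  intro n
  refine summable_of_hasFiniteSupport ((Set.finite_Icc m (n - f.order)).subset fun i hi => ?_)
  by_contra h
  rw [Set.mem_Icc, not_and_or, not_le, not_le] at h
  refine hi ?_
  rcases h with h | h
  · simp [hE i h]
  · simp [HahnSeries.coeff_eq_zero_of_lt_order (show n - i < f.order by omega)]

variable [Algebra ℂ R] (X : Derivation ℂ R R)

@[simp] theorem lieD_coeff (f : LaurentSeries R) (n : ℤ) :
    (lieD X f).coeff n = X (f.coeff n) := rfl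

theorem lieD_mul (f g : LaurentSeries R) : lieD X (f * g) = lieD X f * g + f * lieD X g := by
  ext n
  have hs : ∀ h : LaurentSeries R, (lieD X h).support ⊆ h.support :=
    fun h n hn hz => hn (by simp [show h.coeff n = 0 from hz])
  rw [lieD_coeff, HahnSeries.coeff_add, HahnSeries.coeff_mul,
    HahnSeries.coeff_mul_left' f.isPWO_support (hs f),
    HahnSeries.coeff_mul_right' g.isPWO_support (hs g), ← Finset.sum_add_distrib, map_sum]
  refine Finset.sum_congr rfl fun ij _ => ?_
  simp only [Derivation.leibniz, lieD_coeff, smul_eq_mul]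
  ring

theorem lieD_add (f g : LaurentSeries R) : lieD X (f + g) = lieD X f + lieD X g := by
  ext n
  simp

theorem lieD_neg (f : LaurentSeries R) : lieD X (-f) = -lieD X f := by
  ext n
  simp

end Laurent

/-! ### The derivative of the determinant -/

section Det

variable {R : Type*} [CommRing R] {S : Loop R}

theorem IsTwisted.det_eq (hS : IsTwisted S) : S.det = -(S 0 0 * S 0 0 + S 0 1 * S 1 0) := by
  rw [Matrix.det_fin_two, hS.1]
  ring

/-- If `dS + [φ, S] + S σ̇ + Ṡ σ = φ̇`, then `d det S = -tr (S φ̇) - 2 σ̇ det S - σ (det S)˙`,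
because `det S = -½ tr S²` for trace-free `S` and the commutator is orthogonal to `S`. -/
theorem lieD_det [Algebra ℂ R] (X : Derivation ℂ R R) {φ φ' : Loop R} {s : LaurentSeries R}
    (hS : IsTwisted S) (h : lieDM X S + ⁅φ, S⁆ + (euler s • S + s • eulerM S) = φ') :
    lieD X S.det = -Matrix.trace (S * φ') - 2 * (euler s * S.det) - s * euler S.det := by
  have h11 : S 1 1 = -S 0 0 := hS.1
  subst h
  rw [hS.det_eq, lieD_neg, lieD_add, lieD_mul, lieD_mul, euler_neg, euler_add, euler_mul,
    euler_mul]
  simp only [Ring.lie_def, Matrix.trace_fin_two, Matrix.mul_apply, Fin.sum_univ_two,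
    Matrix.add_apply, Matrix.sub_apply, Matrix.smul_apply, smul_eq_mul, lieDM, eulerM,
    Matrix.map_apply, h11, lieD_neg, euler_neg]
  ring

theorem Hierarchy.lieD_det [StarRing R] [Algebra ℂ R] [TopologicalSpace R] {V : VectorFields R}
    {N : ℕ} {γ : ℝ} (H : Hierarchy V N γ) (X : V.carrier) :
    lieD X.1 H.S.det = -Matrix.trace (H.S * eulerM (H.toData.φ X)) := by
  have h0 : euler (0 : LaurentSeries R) = 0 := by
    ext n
    simp
  simpa [h0] using CMC.lieD_det X.1 (s := 0) H.S_twisted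
    (by simpa [h0] using H.eq_S X)

theorem Hierarchy.isPotential [StarRing R] [Algebra ℂ R] [TopologicalSpace R]
    {V : VectorFields R} {N : ℕ} {γ : ℝ} (H : Hierarchy V N γ) :
    IsPotential V H.φS H.logTau := fun X => by
  simpa [logTau, φS, res] using congrArg (HahnSeries.coeff · 0) (H.lieD_det X)

end Det

/-! ### The extended hierarchy -/

section Extended

/-- The coefficients of `λ⁰` in the Leibniz rule
`d (e^u D) = -e^u T - (σ e^u D)˙`, where `d (e^u) = e^u σ̇ - (e^u)˙ σ` and
`d D = -T - 2 σ̇ D - σ Ḋ`.  As `e^u D` may be an infinite sum, `d` is applied termwise, and the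
sums over shifts of `e^u D` and of `(e^u)˙ D` that make up the coefficient of `(σ e^u D)˙` cancel
after reindexing. -/
theorem hasSum_mul_coeff_neg {R : Type*} [CommRing R] [Algebra ℂ R] [TopologicalSpace R]
    [IsTopologicalRing R] {X : Derivation ℂ R R} (hX : Continuous X) {E : ℤ → R}
    {D T s : LaurentSeries R} {F : Finset ℤ} (hF : ∀ j ∉ F, s.coeff j = 0)
    (hE : ∀ n, X (E n) = polyMul (euler s) E n - polyMul s (eulerZ E) n)
    (hD : lieD X D = -T - 2 * (euler s * D) - s * euler D)
    (hED : ProductExists E D) (hED' : ProductExists (eulerZ E) D) :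
    HasSum (fun i : ℤ => E i * T.coeff (-i)) (-X (resMul E D)) := by
  have hF' : ∀ j ∉ F, (euler s).coeff j = 0 := fun j hj => by simp [hF j hj]
  have h0 : HasSum (fun i : ℤ => X (E i * D.coeff (-i))) (X (resMul E D)) := by
    have h := hED 0
    simp only [zero_sub] at h
    exact h.hasSum.map X hX
  -- The contribution of `λʲ` in `s` to `-(s E D)˙`: two copies of one sum that differ by the shift
  -- `i ↦ i - j` of the summation index.
  have hj : ∀ j : ℤ, HasSum (fun i : ℤ => s.coeff j *
      ((j : R) * (E (i - j) * D.coeff (-j - (i - j))) - eulerZ E (i - j) * D.coeff (-j - (i - j))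
        - ((j : R) * (E i * D.coeff (-j - i)) - eulerZ E i * D.coeff (-j - i)))) 0 := by
    intro j
    have hA := ((hED (-j)).hasSum.mul_left (j : R)).sub (hED' (-j)).hasSum
    have hB := (Equiv.subRight j).hasSum_iff.2 hA
    simpa using (hB.sub hA).mul_left (s.coeff j)
  have h := (hasSum_sum (s := F) fun j _ => hj j).sub h0
  rw [Finset.sum_const_zero, zero_sub] at h
  refine h.congr_fun fun i => ?_
  have hDi : X (D.coeff (-i)) = -T.coeff (-i)
      - 2 * (∑ j ∈ F, (j : R) * s.coeff j * D.coeff (-i - j))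
      - ∑ j ∈ F, s.coeff j * (((-i - j : ℤ) : R) * D.coeff (-i - j)) := by
    have h := congrArg (HahnSeries.coeff · (-i)) hD
    simpa only [lieD_coeff, HahnSeries.coeff_sub, HahnSeries.coeff_neg, two_mul,
      HahnSeries.coeff_add, coeff_mul_of_support_subset hF, coeff_mul_of_support_subset hF',
      euler_coeff] using h
  rw [Derivation.leibniz, smul_eq_mul, smul_eq_mul, hDi, hE, polyMul_of_support_subset hF,
    polyMul_of_support_subset hF']
  -- These contributions are the terms of the Leibniz rule that contain `s`.
  have hcomb : ∑ j ∈ F, s.coeff j *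
      ((j : R) * (E (i - j) * D.coeff (-j - (i - j))) - eulerZ E (i - j) * D.coeff (-j - (i - j))
        - ((j : R) * (E i * D.coeff (-j - i)) - eulerZ E i * D.coeff (-j - i)))
      = (∑ j ∈ F, (euler s).coeff j * E (i - j) - ∑ j ∈ F, s.coeff j * eulerZ E (i - j))
          * D.coeff (-i)
        - E i * (2 * (∑ j ∈ F, (j : R) * s.coeff j * D.coeff (-i - j))
          + ∑ j ∈ F, s.coeff j * (((-i - j : ℤ) : R) * D.coeff (-i - j))) := by
    simp only [Finset.mul_sum, ← Finset.sum_sub_distrib, ← Finset.sum_add_distrib,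
      Finset.sum_mul]
    refine Finset.sum_congr rfl fun j _ => ?_
    rw [show -j - (i - j) = -i by ring, show -j - i = -i - j by ring]
    simp only [eulerZ, euler_coeff]
    push_cast
    ring
  rw [hcomb]
  ring

variable {R : Type*} [CommRing R] [StarRing R] [Algebra ℂ R] [TopologicalSpace R]
  {V : VectorFields R} {N : ℕ} {γ : ℝ} {ε : VirType}

/-- For the positive type both factors are bounded below in degree, so that the products exist
unconditionally. -/
theorem ExtHierarchy.productExists (H : ExtHierarchy V N γ ε)
    (h : ε = .neg → ProductExists H.E H.S.det ∧ ProductExists (eulerZ H.E) H.S.det) :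
    ProductExists H.E H.S.det ∧ ProductExists (eulerZ H.E) H.S.det := by
  cases ε with
  | neg => exact h rfl
  | pos =>
    have hE : ∀ n : ℤ, n < 2 * N + 2 → H.E n = 0 := H.E_support
    exact ⟨productExists_of_bddBelow hE _,
      productExists_of_bddBelow (fun n hn => eulerZ_eq_zero (hE n hn)) _⟩

theorem ExtHierarchy.hasSum_φS [IsTopologicalRing R] (H : ExtHierarchy V N γ ε)
    (h : ProductExists H.E H.S.det ∧ ProductExists (eulerZ H.E) H.S.det) (X : V.carrier) :
    HasSum (fun i : ℤ => H.E i * (Matrix.trace (H.S * eulerM (H.hatφ X))).coeff (-i))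
      (-X.1 H.logTau) := by
  obtain ⟨F, hF⟩ := ε.exists_support_series (H.σ X)
  exact hasSum_mul_coeff_neg (V.continuous _ X.2) hF (H.eq_E X)
    (lieD_det X.1 H.S_twisted (H.eq_S X)) h.1 h.2

theorem ExtHierarchy.isPotential [IsTopologicalRing R] [T2Space R] (H : ExtHierarchy V N γ ε)
    (h : ProductExists H.E H.S.det ∧ ProductExists (eulerZ H.E) H.S.det) :
    IsPotential V H.φS H.logTau := fun X => by
  rw [φS, resMul, (H.hasSum_φS h X).tsum_eq, neg_neg]

end Extended

end CMC

theorem mainTheorem2 {R : Type*} [CommRing R] [StarRing R] [Algebra ℂ R] [StarModule ℂ R]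
    [Algebra ℚ R] [UniformSpace R] [CMC.IsFunctionAlgebra R]
    (V : CMC.VectorFields R) (N : ℕ) (γ : ℝ) :
    (∀ (ε : CMC.VirType) (H : CMC.ExtHierarchy V N γ ε),
      -- for the negative type the products below are infinite sums, which have to exist
      (ε = CMC.VirType.neg →
        CMC.ProductExists H.E H.S.det ∧ CMC.ProductExists (CMC.eulerZ H.E) H.S.det) →
      (Summable fun i : ℤ => H.E i * H.S.det.coeff (-i)) ∧
      (∀ X : V.carrier, Summable fun i : ℤ =>
        H.E i * (Matrix.trace (H.S * CMC.eulerM (H.hatφ X))).coeff (-i)) ∧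
      CMC.IsClosedForm V H.φS ∧
      CMC.IsPotential V H.φS H.logTau ∧
      CMC.IsTau V H.φS (NormedSpace.exp H.logTau) ∧
      (∀ τ : R, CMC.IsTau V H.φS τ ↔
        ∃ c : R, IsUnit c ∧ (∀ X : V.carrier, X.1 c = 0) ∧
          τ = c * NormedSpace.exp H.logTau)) ∧
    (∀ H : CMC.Hierarchy V N γ,
      (∀ X : V.carrier, CMC.lieD X.1 H.S.det =
        -Matrix.trace (H.S * CMC.eulerM (H.toData.φ X))) ∧
      CMC.IsClosedForm V H.φS ∧
      CMC.IsPotential V H.φS H.logTau ∧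
      CMC.IsTau V H.φS (NormedSpace.exp H.logTau) ∧
      (∀ τ : R, CMC.IsTau V H.φS τ ↔
        ∃ c : R, IsUnit c ∧ (∀ X : V.carrier, X.1 c = 0) ∧
          τ = c * NormedSpace.exp H.logTau)) := by
  refine ⟨fun ε H hprod => ?_, fun H => ?_⟩
  · have h := H.productExists hprod
    have hpot := H.isPotential h
    exact ⟨by simpa using h.1 0, fun X => (H.hasSum_φS h X).summable, hpot.isClosedForm, hpot,
      hpot.isTau_exp, hpot.isTau_iff⟩
  · have hpot := H.isPotential
    exact ⟨H.lieD_det, hpot.isClosedForm, hpot, hpot.isTau_exp, hpot.isTau_iff⟩
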